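/- **Corollary (Divisibility of the Laguerre polynomials).** Let $1\le d\le m$ be integers and put $\lambda=d/m$. Let $$L_d^{(m-d)}(x)=\sum_{i=0}^{d}(-1)^i\binom{m}{d-i}\frac{x^i}{i!}$$ be the generalized Laguerre polynomial of degree $d$ and parameter $m-d$. For real $m\times d$ matrices $A,B$ and real polynomials $p=a\det(x\mathbb I_d-A^TA)$, $q=b\det(x\mathbb I_d-B^TB)$ with $a,b\in\mathbb R$, the $\lambda$-rectangular additive convolution of $p$ and $q$ is $$[p\boxplus_{d,\lambda}q](x)=ab\int_{O(m)}\int_{O(d)}\det\!\big(x\mathbb I_d-(A+QBR^T)^T(A+QBR^T)\big)\,dR\,dQ,$$ where $dQ,dR$ are the normalized Haar measures on the orthogonal groups. Let $\sigma,\tau$ be real with $\sigma^2,\tau^2>0$. Then $L_d^{(m-d)}(x/\sigma^2)$ and $L_d^{(m-d)}(x/\tau^2)$ are scalar multiples of polynomials of the form $\det(x\mathbb I_d-A^TA)$ with $A$ a real $m\times d$ matrix, their convolution is a polynomial that does not depend on the choice of the matrices $A,B$ representing them, and there is a real constant $c\neq 0$ such that $$L_d^{(m-d)}\!\left(\frac{x}{\sigma^2+\tau^2}\right)=c\,\Big[L_d^{(m-d)}\!\left(\frac{\cdot}{\sigma^2}\right)\boxplus_{d,\lambda}L_d^{(m-d)}\!\left(\frac{\cdot}{\tau^2}\right)\Big](x).$$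 -/

import Mathlib

open Polynomial MeasureTheory

noncomputable section

/-- The generalized Laguerre polynomial
`L_n^{(α)}(x) = ∑_{i=0}^n (-1)^i * binom (n + α) (n - i) * x^i / i!`
(for a nonnegative integer parameter `α`). -/
def laguerrePoly (n α : ℕ) : ℝ[X] :=
  ∑ i ∈ Finset.range (n + 1),
    C ((-1 : ℝ) ^ i * ((n + α).choose (n - i) : ℝ) / (i.factorial : ℝ)) * X ^ i

/-- `p ≈ q`: the polynomials agree up to a nonzero scalar factor. -/
def EqUpToScaling (p q : ℝ[X]) : Prop :=
  ∃ c : ℝ, c ≠ 0 ∧ p = C c * q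

/-! ### Normalized Haar measure on the orthogonal group -/

instance orthogonalMeasurableSpace (n : ℕ) :
    MeasurableSpace (Matrix.orthogonalGroup (Fin n) ℝ) :=
  borel _

instance orthogonalBorelSpace (n : ℕ) :
    BorelSpace (Matrix.orthogonalGroup (Fin n) ℝ) :=
  ⟨rfl⟩

instance orthogonalCompactSpace (n : ℕ) :
    CompactSpace (Matrix.orthogonalGroup (Fin n) ℝ) := by
  refine isCompact_iff_compactSpace.mp ?_
  have hK : IsCompact (Set.pi Set.univ (fun _ : Fin n =>
      Set.pi Set.univ (fun _ : Fin n => Metric.closedBall (0 : ℝ) 1))) :=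
    isCompact_univ_pi fun _ => isCompact_univ_pi fun _ => isCompact_closedBall _ _
  have hc : IsClosed (unitary (Matrix (Fin n) (Fin n) ℝ) :
      Set (Matrix (Fin n) (Fin n) ℝ)) := isClosed_unitary
  refine IsCompact.of_isClosed_subset (X := Matrix (Fin n) (Fin n) ℝ) hK hc ?_
  intro U hU i _ j _
  rw [mem_closedBall_zero_iff]
  exact entry_norm_bound_of_unitary hU i j

/-- The Haar measure on the orthogonal group `O(n)`, normalized to have total mass one. -/
def orthogonalHaar (n : ℕ) : Measure (Matrix.orthogonalGroup (Fin n) ℝ) :=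
  Measure.haarMeasure ⊤

instance orthogonalHaar_isProbabilityMeasure (n : ℕ) :
    IsProbabilityMeasure (orthogonalHaar n) :=
  ⟨by simpa [orthogonalHaar] using
    (Measure.haarMeasure_self
      (K₀ := (⊤ : TopologicalSpace.PositiveCompacts (Matrix.orthogonalGroup (Fin n) ℝ))))⟩

/-! ### The rectangular additive convolution -/

/-- The average, at the point `x`, of the characteristic polynomials of
`(A + Q B Rᵀ)ᵀ (A + Q B Rᵀ)` over independent Haar distributed orthogonal matrices
`Q ∈ O(m)` and `R ∈ O(d)`. -/
def avgCharpoly {m d : ℕ} (A B : Matrix (Fin m) (Fin d) ℝ) (x : ℝ) : ℝ :=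
  ∫ Q : Matrix.orthogonalGroup (Fin m) ℝ, ∫ R : Matrix.orthogonalGroup (Fin d) ℝ,
    Matrix.det (x • (1 : Matrix (Fin d) (Fin d) ℝ) -
      (A + Q.val * B * R.val.transpose).transpose * (A + Q.val * B * R.val.transpose))
    ∂(orthogonalHaar d) ∂(orthogonalHaar m)

/-- `p` is, up to its leading coefficient, the characteristic polynomial of `Aᵀ A`. -/
def IsSingularCharpoly {m d : ℕ} (A : Matrix (Fin m) (Fin d) ℝ) (p : ℝ[X]) : Prop :=
  p = C p.leadingCoeff * (A.transpose * A).charpoly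

/-- `r` is the `λ`-rectangular additive convolution `p ⊞_{d,λ} q`, where `λ = d / m`.
Both `p` and `q` are scalar multiples of polynomials `det (x I - Aᵀ A)` and `det (x I - Bᵀ B)`
for some real `m × d` matrices `A` and `B`; and for all such `A` and `B`, the polynomial `r` is
the average of the characteristic polynomials of `(A + Q B Rᵀ)ᵀ (A + Q B Rᵀ)` over the orthogonal
groups, extended bilinearly from monic `p` and `q` to scalar multiples. -/
def IsRectConv (m d : ℕ) (p q r : ℝ[X]) : Prop :=
  (∃ A : Matrix (Fin m) (Fin d) ℝ, IsSingularCharpoly A p) ∧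
  (∃ B : Matrix (Fin m) (Fin d) ℝ, IsSingularCharpoly B q) ∧
  ∀ A B : Matrix (Fin m) (Fin d) ℝ, IsSingularCharpoly A p → IsSingularCharpoly B q →
    ∀ x : ℝ, r.eval x = p.leadingCoeff * q.leadingCoeff * avgCharpoly A B x

end

/-! Write D for `derivative`. Up to a scalar, the Laguerre polynomial at scale s is (1 - sD)^m X^d
(`laguerrePoly_comp_eq`). It is also the mean characteristic polynomial of VᵀV for a finitely
supported random matrix V with independent centred rows of covariance s·1. More generally, the mean
for A + V is the linear operator `rectOp` applied to the characteristic polynomial of AᵀA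
(`IsIsotropic.sum_charpoly_gram`), and on Laguerre polynomials this operator adds s to the scale
(`rectOp_monicLaguerre`).

On the other side, `avgCharpoly A B x` is linear in the characteristic polynomial of BᵀB
(`exists_linear_avgCharpoly`), so a B with Laguerre characteristic polynomial may be replaced by the
random V. For fixed Q and R the mean over V of the integrand is already the `rectOp` value, since Q
can be moved onto A and the row law stays isotropic under R. The Haar integrals are then integrals
of a constant (`avgCharpoly_eq_rectOp`). -/

noncomputable section

open Matrix

/-! ### Rank one perturbations of characteristic polynomials -/

/-- A characteristic matrix need not be invertible over ℝ[X], but its determinant is nonzero. The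
matrix determinant lemma is therefore used in the fraction field, with the inverse written through
the adjugate. -/
theorem det_add_vecMulVec_of_det_ne_zero {n R : Type*} [Fintype n] [DecidableEq n] [CommRing R]
    [IsDomain R] {N : Matrix n n R} (hN : N.det ≠ 0) (u v : n → R) :
    (N + vecMulVec u v).det = N.det + v ⬝ᵥ N.adjugate *ᵥ u := by
  let K := FractionRing R
  let φ : R →+* K := algebraMap R K
  have hφ : Function.Injective φ := IsFractionRing.injective R K
  apply hφ
  have hu : IsUnit (φ.mapMatrix N).det := by
    rw [← RingHom.map_det]
    exact isUnit_iff_ne_zero.mpr ((map_ne_zero_iff φ hφ).mpr hN)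
  have h := det_add_replicateCol_mul_replicateRow (ι := Unit) hu (φ ∘ u) (φ ∘ v)
  rw [← vecMulVec_eq] at h
  rw [RingHom.map_det, map_add, map_add, RingHom.map_det, RingHom.map_dotProduct,
    RingHom.mapMatrix_apply (M := vecMulVec u v)]
  have e : (vecMulVec u v).map φ = vecMulVec (φ ∘ u) (φ ∘ v) := by
    ext i j; simp [vecMulVec_apply]
  have ha : (φ.mapMatrix N).adjugate = (φ.mapMatrix N).det • (φ.mapMatrix N)⁻¹ := by
    rw [inv_def, smul_smul, Ring.mul_inverse_cancel _ hu, one_smul]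
  have hv : φ ∘ (N.adjugate *ᵥ u) = (φ.mapMatrix N).adjugate *ᵥ (φ ∘ u) := by
    rw [← RingHom.map_adjugate]
    ext i
    exact RingHom.map_mulVec φ N.adjugate u i
  rw [e, h, hv, ha, det_unique (n := Unit), smul_mulVec, dotProduct_smul, Matrix.add_apply, mul_add,
    one_apply_eq, mul_one, smul_eq_mul, Matrix.mul_assoc, ← replicateCol_mulVec,
    replicateRow_mul_replicateCol_apply]

theorem derivative_det {n R : Type*} [Fintype n] [DecidableEq n] [CommRing R]
    (N : Matrix n n R[X]) :
    derivative N.det = ∑ i, (N.updateRow i (fun j => derivative (N i j))).det := by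
  have expand : ∀ A : Matrix n n R[X],
      A.det = ∑ σ : Equiv.Perm n, ((Equiv.Perm.sign σ : ℤ) : R[X]) * ∏ i, A i (σ i) :=
    fun A => by rw [← det_transpose, det_apply']; rfl
  simp only [expand, derivative_sum]
  rw [Finset.sum_comm]
  refine Finset.sum_congr rfl fun σ _ => ?_
  rw [derivative_intCast_mul, derivative_prod_finset, Finset.mul_sum]
  refine Finset.sum_congr rfl fun i _ => ?_
  rw [← Finset.prod_erase_mul _ _ (Finset.mem_univ i), updateRow_self]
  congr 2
  refine Finset.prod_congr rfl fun j hj => ?_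
  rw [updateRow_ne (Finset.ne_of_mem_erase hj)]

/-- Differentiating row i of xI - M leaves a unit vector, so each term of the row-wise product rule
is a diagonal cofactor. -/
theorem derivative_charpoly {n R : Type*} [Fintype n] [DecidableEq n] [CommRing R]
    (M : Matrix n n R) : derivative M.charpoly = M.charmatrix.adjugate.trace := by
  rw [Matrix.charpoly, derivative_det, trace]
  refine Finset.sum_congr rfl fun i _ => ?_
  rw [diag_apply, adjugate_apply]
  congr 2
  ext j
  by_cases h : i = j
  · subst h; simp
  · simp [h, Ne.symm h]

theorem charpoly_add_vecMulVec {n : Type*} [Fintype n] [DecidableEq n]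
    (M : Matrix n n ℝ) (v : n → ℝ) :
    (M + vecMulVec v v).charpoly =
      M.charpoly - ∑ i, ∑ j, C (v i * v j) * M.charmatrix.adjugate i j := by
  have e : (M + vecMulVec v v).charmatrix =
      M.charmatrix + vecMulVec (fun i => C (- v i)) (fun i => C (v i)) := by
    ext i j : 2
    simp [charmatrix_apply, vecMulVec_apply]
    ring
  rw [Matrix.charpoly, e, det_add_vecMulVec_of_det_ne_zero M.charpoly_monic.ne_zero,
    ← Matrix.charpoly, sub_eq_add_neg, ← Finset.sum_neg_distrib]
  congr 1
  simp only [dotProduct, mulVec, Finset.mul_sum, ← Finset.sum_neg_distrib]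
  refine Finset.sum_congr rfl fun i _ => Finset.sum_congr rfl fun j _ => ?_
  simp only [map_neg, map_mul]
  ring

/-! ### Averages over isotropic perturbations of the rows -/

/-- A finitely supported law with weights `w` on vectors `v ω`, of total mass one, centred and
with covariance matrix `s • 1`. -/
structure IsIsotropic {Ω n : Type*} [Fintype Ω] [DecidableEq n] (w : Ω → ℝ)
    (v : Ω → n → ℝ) (s : ℝ) : Prop where
  mass : ∑ ω, w ω = 1
  mean : ∀ i, ∑ ω, w ω * v ω i = 0
  cov : ∀ i j, ∑ ω, w ω * (v ω i * v ω j) = if i = j then s else 0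

/-- The rank one formula is quadratic in the vector, so only two moments enter: the mean part
restores the update by a, and the covariance s·1 picks out the trace of the adjugate, which is the
derivative. -/
theorem IsIsotropic.sum_charpoly {Ω n : Type*} [Fintype Ω] [Fintype n] [DecidableEq n]
    {w : Ω → ℝ} {v : Ω → n → ℝ} {s : ℝ} (h : IsIsotropic w v s) (M : Matrix n n ℝ) (a : n → ℝ) :
    ∑ ω, w ω • (M + vecMulVec (a + v ω) (a + v ω)).charpoly =
      (M + vecMulVec a a).charpoly - s • derivative M.charpoly := by
  have key : ∀ i j, ∑ ω, w ω * ((a i + v ω i) * (a j + v ω j)) =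
      a i * a j + if i = j then s else 0 := by
    intro i j
    have : ∀ ω, w ω * ((a i + v ω i) * (a j + v ω j)) = w ω * (a i * a j) +
        a i * (w ω * v ω j) + a j * (w ω * v ω i) + w ω * (v ω i * v ω j) := fun ω => by ring
    simp only [this, Finset.sum_add_distrib, ← Finset.mul_sum, ← Finset.sum_mul, h.mass, h.mean,
      h.cov]
    ring
  simp only [charpoly_add_vecMulVec, smul_sub, Finset.sum_sub_distrib, ← Finset.sum_smul, h.mass,
    one_smul, Finset.smul_sum]
  rw [sub_sub, Finset.sum_comm]
  congr 1
  rw [derivative_charpoly, trace, Finset.smul_sum, ← Finset.sum_add_distrib]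
  refine Finset.sum_congr rfl fun i _ => ?_
  rw [Finset.sum_comm]
  have : ∀ j, ∑ ω, w ω • (C ((a + v ω) i * (a + v ω) j) * M.charmatrix.adjugate i j) =
      C (a i * a j) * M.charmatrix.adjugate i j +
        if i = j then s • M.charmatrix.adjugate i j else 0 := by
    intro j
    simp only [← smul_mul_assoc, ← Finset.sum_mul, smul_C, smul_eq_mul, ← map_sum, Pi.add_apply,
      key]
    split_ifs <;> simp [add_mul, smul_eq_C_mul]
  simp only [this, Finset.sum_add_distrib]
  simp

/-- Rows are averaged independently. The value `r k = true` marks a row that contributed its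
derivative term and hence disappeared from the Gram matrix. -/
theorem IsIsotropic.sum_charpoly_rows {Ω n : Type*} [Fintype Ω] [Fintype n] [DecidableEq n]
    {w : Ω → ℝ} {v : Ω → n → ℝ} {s : ℝ} (h : IsIsotropic w v s) {m : ℕ} (M : Matrix n n ℝ)
    (a : Fin m → n → ℝ) :
    ∑ ω : Fin m → Ω, (∏ k, w (ω k)) •
        (M + ∑ k, vecMulVec (a k + v (ω k)) (a k + v (ω k))).charpoly =
      ∑ r : Fin m → Bool, ((-s • derivative : Module.End ℝ ℝ[X]) ^ (∑ k, (r k).toNat))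
        (M + ∑ k, if r k then 0 else vecMulVec (a k) (a k)).charpoly := by
  induction m generalizing M with
  | zero => simp
  | succ m ih =>
    rw [← (Fin.consEquiv fun _ => Ω).sum_comp, ← (Fin.consEquiv fun _ => Bool).sum_comp,
      Fintype.sum_prod_type_right, Fintype.sum_prod_type]
    simp only [Fin.consEquiv_apply, Fin.prod_univ_succ, Fin.sum_univ_succ, Fin.cons_zero,
      Fin.cons_succ, Fintype.sum_bool, Bool.toNat_true, Bool.toNat_false, pow_add, pow_one,
      pow_zero, if_true, Bool.false_eq_true, if_false, Module.End.mul_apply,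
      ← map_sum, ← add_assoc, add_zero, Module.End.one_apply]
    -- The two uses of the induction hypothesis correspond to row 0 being dropped and being kept.
    rw [← ih M (fun k => a k.succ), ← ih _ (fun k => a k.succ), map_sum, ← Finset.sum_add_distrib]
    refine Finset.sum_congr rfl fun ω _ => ?_
    have := h.sum_charpoly (M + ∑ k, vecMulVec (a k.succ + v (ω k)) (a k.succ + v (ω k))) (a 0)
    rw [map_smul, ← smul_add]
    simp only [mul_comm (w _), mul_smul, ← Finset.smul_sum]
    congr 1
    simp only [add_right_comm M _ (∑ k, _), this]
    simp [sub_eq_neg_add]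

theorem transpose_mul_self_eq_sum {m n : Type*} [Fintype m] (A : Matrix m n ℝ) :
    Aᵀ * A = ∑ k, vecMulVec (A k) (A k) := by
  ext i j
  simp [Matrix.mul_apply, Matrix.sum_apply, vecMulVec_apply]

/-! ### Removing rows -/

theorem neg_smul_derivative (s : ℝ) :
    (-s • derivative : Module.End ℝ ℝ[X]) = -(s • derivative) :=
  LinearMap.ext fun p => _root_.neg_smul s (derivative p)

theorem add_smul_derivative (s t : ℝ) :
    ((s + t) • derivative : Module.End ℝ ℝ[X]) = s • derivative + t • derivative :=
  LinearMap.ext fun p => _root_.add_smul s t (derivative p)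

theorem transpose_mul_diagonal_mul_eq_sum {m n : Type*} [Fintype m] [DecidableEq m]
    (A : Matrix m n ℝ) (r : m → Bool) :
    Aᵀ * (diagonal (fun k => if r k then (0 : ℝ) else 1) * A) =
      ∑ k, if r k then 0 else vecMulVec (A k) (A k) := by
  ext i j
  rw [Matrix.mul_apply, Matrix.sum_apply]
  refine Finset.sum_congr rfl fun k _ => ?_
  cases h : r k <;> simp [h, vecMulVec_apply]

theorem det_charmatrix_add_smul {m : Type*} [Fintype m] [DecidableEq m]
    (N : Matrix m m ℝ) (u : ℝ) :
    (N.charmatrix + (C u * X) • (1 : Matrix m m ℝ[X])).det =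
      N.charpoly.comp (C (1 + u) * X) := by
  rw [Matrix.charpoly, ← coe_compRingHom_apply, RingHom.map_det]
  congr 1
  ext i j : 2
  by_cases h : i = j
  · subst h; simp [add_mul]; ring
  · simp [h]

/-- Multilinear expansion along rows: choosing the summand uX in row k, with u factored out, leaves
row k of the characteristic matrix of N with that row set to zero. -/
theorem det_charmatrix_add_smul_eq_sum {m : Type*} [Fintype m] [DecidableEq m]
    (N : Matrix m m ℝ) (u : ℝ) :
    (N.charmatrix + (C u * X) • (1 : Matrix m m ℝ[X])).det =
      ∑ r : m → Bool, C (u ^ ∑ k, (r k).toNat) *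
        (diagonal (fun k => if r k then (0 : ℝ) else 1) * N).charpoly := by
  let g : m → Bool → m → ℝ[X] := fun i b =>
    if b then ((C u * X) • (1 : Matrix m m ℝ[X])) i else N.charmatrix i
  have h := (detRowAlternating (R := ℝ[X]) (n := m)).toMultilinearMap.map_sum g
  have e : (fun i => ∑ b, g i b) = N.charmatrix + (C u * X) • (1 : Matrix m m ℝ[X]) := by
    ext i j : 2
    simp only [g, Fintype.sum_bool, if_true, Bool.false_eq_true, if_false]
    exact add_comm _ _
  rw [e] at h
  refine h.trans (Finset.sum_congr rfl fun r _ => ?_)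
  have hc : C (u ^ ∑ k, (r k).toNat) = ∏ k, (if r k then C u else 1 : ℝ[X]) := by
    rw [← Finset.prod_pow_eq_pow_sum, map_prod]
    refine Finset.prod_congr rfl fun k _ => ?_
    cases r k <;> simp
  rw [hc, Matrix.charpoly, ← det_mul_column]
  change Matrix.det _ = Matrix.det _
  congr 1
  ext i j : 2
  by_cases hij : i = j
  · subst hij; cases hr : r i <;> simp [g, hr]
  · cases hr : r i <;> simp [g, hr, hij]

/-- Deleting rows of A is left multiplication by a diagonal matrix, so the two evaluations of the
determinant are applied to AAᵀ. Returning to d × d matrices costs X^(m-d) on both sides;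
substituting (1+u)X there produces the factor (1+u)^(m-d). -/
theorem sum_charpoly_remove_rows {m d : ℕ} (hdm : d ≤ m) (A : Matrix (Fin m) (Fin d) ℝ) (u : ℝ) :
    ∑ r : Fin m → Bool, C (u ^ ∑ k, (r k).toNat) *
        (∑ k, if r k then 0 else vecMulVec (A k) (A k)).charpoly =
      C ((1 + u) ^ (m - d)) * (Aᵀ * A).charpoly.comp (C (1 + u) * X) := by
  have h := (det_charmatrix_add_smul_eq_sum (A * Aᵀ) u).symm.trans (det_charmatrix_add_smul _ u)
  have hc : Fintype.card (Fin d) ≤ Fintype.card (Fin m) := by simpa using hdm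
  rw [charpoly_mul_comm_of_le _ _ hc] at h
  simp only [← Matrix.mul_assoc] at h
  simp only [charpoly_mul_comm_of_le _ _ hc, transpose_mul_diagonal_mul_eq_sum,
    Fintype.card_fin] at h
  apply mul_left_cancel₀ (pow_ne_zero (m - d) (X_ne_zero (R := ℝ)))
  rw [Finset.mul_sum]
  calc _ = _ := Finset.sum_congr rfl fun r _ => by ring
    _ = _ := h
    _ = _ := by simp [mul_pow]; ring

/-- The operator sending `X ^ j` to `(1 - s • derivative) ^ (m - d + j) (X ^ j)` for `j ≤ d`. -/
def rectOp (m d : ℕ) (s : ℝ) : ℝ[X] →ₗ[ℝ] ℝ[X] :=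
  ∑ j ∈ Finset.range (d + 1), (lcoeff ℝ j).smulRight
    (((1 - s • derivative : Module.End ℝ ℝ[X]) ^ (m - d + j)) (X ^ j))

theorem rectOp_apply (m d : ℕ) (s : ℝ) (p : ℝ[X]) :
    rectOp m d s p = ∑ j ∈ Finset.range (d + 1),
      p.coeff j • ((1 - s • derivative : Module.End ℝ ℝ[X]) ^ (m - d + j)) (X ^ j) := by
  simp [rectOp]

theorem sum_derivative_charpoly_remove_rows {m d : ℕ} (hdm : d ≤ m)
    (A : Matrix (Fin m) (Fin d) ℝ) (s : ℝ) :
    ∑ r : Fin m → Bool, ((-s • derivative : Module.End ℝ ℝ[X]) ^ (∑ k, (r k).toNat))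
        (∑ k, if r k then 0 else vecMulVec (A k) (A k)).charpoly =
      rectOp m d s (Aᵀ * A).charpoly := by
  set q : (Fin m → Bool) → ℝ[X] := fun r =>
    (∑ k, if r k then 0 else vecMulVec (A k) (A k)).charpoly with hq
  -- Coefficientwise the row-removal identity is polynomial in u, here written X, so the operator
  -- -sD may be substituted for u.
  have hcoeff : ∀ j, ∑ r : Fin m → Bool, C ((q r).coeff j) * X ^ (∑ k, (r k).toNat) =
      C ((Aᵀ * A).charpoly.coeff j) * (1 + X) ^ (m - d + j) := by
    intro j
    refine Polynomial.funext fun u => ?_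
    have := congrArg (fun p => coeff p j) (sum_charpoly_remove_rows hdm A u)
    simp only [finsetSum_coeff, coeff_C_mul, comp_C_mul_X_coeff] at this
    simp only [eval_finsetSum, eval_mul, eval_C, eval_pow, eval_X, eval_add, eval_one]
    rw [pow_add]
    refine Eq.trans (Finset.sum_congr rfl fun r _ => ?_) (this.trans ?_) <;> ring
  have hexp : ∀ r, q r = ∑ j ∈ Finset.range (d + 1), (q r).coeff j • X ^ j := by
    intro r
    simp only [smul_eq_C_mul]
    exact as_sum_range_C_mul_X_pow' _ (by rw [hq]; simp [charpoly_natDegree_eq_dim])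
  rw [rectOp_apply]
  calc ∑ r, ((-s • derivative : Module.End ℝ ℝ[X]) ^ (∑ k, (r k).toNat)) (q r)
      = ∑ r, ∑ j ∈ Finset.range (d + 1), (q r).coeff j •
          ((-s • derivative : Module.End ℝ ℝ[X]) ^ (∑ k, (r k).toNat)) (X ^ j) := by
        refine Finset.sum_congr rfl fun r _ => ?_
        conv_lhs => rw [hexp r]
        simp only [map_sum, map_smul]
    _ = _ := by
        rw [Finset.sum_comm]
        refine Finset.sum_congr rfl fun j _ => ?_
        have := congrArg (fun p => aeval (-s • derivative : Module.End ℝ ℝ[X]) p (X ^ j))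
          (hcoeff j)
        simpa [map_sum, Algebra.algebraMap_eq_smul_one, sub_eq_add_neg, neg_smul_derivative] using this

/-! ### Laguerre polynomials and the action of `rectOp` on them -/

/-- The monic Laguerre polynomial of degree `d`, with roots scaled by `s`. -/
def monicLaguerre (m d : ℕ) (s : ℝ) : ℝ[X] :=
  ((1 - s • derivative : Module.End ℝ ℝ[X]) ^ m) (X ^ d)

theorem monicLaguerre_eq_sum (m d : ℕ) (s : ℝ) :
    monicLaguerre m d s = ∑ k ∈ Finset.range (m + 1),
      (((-s) ^ k * m.choose k) • derivative^[k] (X ^ d) : ℝ[X]) := by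
  have : (1 - s • derivative : Module.End ℝ ℝ[X]) = (-s) • derivative + 1 := by
    rw [neg_smul_derivative, sub_eq_neg_add]
  rw [monicLaguerre, this, (Commute.one_right _).add_pow]
  simp only [one_pow, mul_one, LinearMap.sum_apply, Module.End.mul_apply]
  refine Finset.sum_congr rfl fun k _ => ?_
  rw [_root_.smul_pow, Module.End.natCast_apply, map_nsmul, LinearMap.smul_apply, Module.End.pow_apply,
    mul_comm, mul_smul, Nat.cast_smul_eq_nsmul]

/-- D^k X^d is a multiple of X^(d-k), on which `rectOp` acts as (1 - sD)^(m-k). The sum over k is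
then the binomial expansion of (-tD + (1 - sD))^m. -/
theorem rectOp_monicLaguerre {m d : ℕ} (hdm : d ≤ m) (s t : ℝ) :
    rectOp m d s (monicLaguerre m d t) = monicLaguerre m d (s + t) := by
  have key : ∀ k ∈ Finset.range (m + 1), rectOp m d s (derivative^[k] (X ^ d)) =
      ((1 - s • derivative : Module.End ℝ ℝ[X]) ^ (m - k)) (derivative^[k] (X ^ d)) := by
    intro k hk
    rw [iterate_derivative_X_pow_eq_smul, map_smul, map_smul]
    by_cases hkd : k ≤ d
    · rw [rectOp_apply, Finset.sum_eq_single (d - k)]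
      · rw [coeff_X_pow_self, one_smul]
        congr 3
        omega
      · intro j _ hj
        rw [coeff_X_pow, if_neg hj, zero_smul]
      · intro h
        simp at h
    · rw [Nat.descFactorial_of_lt (by omega)]
      simp
  have hc : Commute (-t • derivative : Module.End ℝ ℝ[X]) (1 - s • derivative) :=
    (Commute.one_right _).sub_right (((Commute.refl _).smul_left _).smul_right _)
  have : (1 - (s + t) • derivative : Module.End ℝ ℝ[X]) =
      (-t) • derivative + (1 - s • derivative) := by
    rw [neg_smul_derivative, add_smul_derivative]; abel
  rw [monicLaguerre_eq_sum, map_sum, monicLaguerre, this, hc.add_pow, LinearMap.sum_apply]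
  refine Finset.sum_congr rfl fun k hk => ?_
  rw [map_smul, key k hk, (hc.pow_pow _ _).eq, Module.End.mul_apply, Module.End.mul_apply,
    Module.End.natCast_apply, ← Nat.cast_smul_eq_nsmul ℝ, _root_.smul_pow, LinearMap.smul_apply,
    map_smul, Module.End.pow_apply derivative, iterate_derivative_smul]
  simp only [map_smul, smul_smul]

/-! ### Rectangular diagonal matrices -/

/-- The `m × d` matrix with diagonal entries `y`. -/
def rectDiag (m : ℕ) {d : ℕ} (y : Fin d → ℝ) : Matrix (Fin m) (Fin d) ℝ :=
  of fun i j => if (i : ℕ) = j then y j else 0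

theorem rectDiag_transpose_mul_self {m d : ℕ} (hdm : d ≤ m) (y : Fin d → ℝ) :
    (rectDiag m y)ᵀ * rectDiag m y = diagonal (fun i => y i ^ 2) := by
  ext i j
  rw [Matrix.mul_apply, Finset.sum_eq_single (Fin.castLE hdm i)]
  · by_cases h : i = j
    · subst h; simp [rectDiag, sq]
    · have : (i : ℕ) ≠ j := fun h' => h (Fin.ext h')
      simp [rectDiag, h, this]
  · intro k _ hk
    have : (k : ℕ) ≠ i := fun h' => hk (Fin.ext h')
    simp [rectDiag, this]
  · simp

theorem rectDiag_update {m d : ℕ} (hdm : d ≤ m) (y : Fin d → ℝ) (i : Fin d) (t : ℝ) :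
    rectDiag m (Function.update y i t) =
      rectDiag m (Function.update y i 0) + Matrix.single (Fin.castLE hdm i) i t := by
  ext k j
  by_cases hj : j = i
  · subst hj
    by_cases hk : (k : ℕ) = j
    · have : Fin.castLE hdm j = k := Fin.ext hk.symm
      simp [rectDiag, this, hk]
    · have : Fin.castLE hdm j ≠ k := fun h => hk (by rw [← h]; rfl)
      simp [rectDiag, this, hk]
  · simp [rectDiag, hj, Ne.symm hj]

theorem charpoly_rectDiag {m d : ℕ} (hdm : d ≤ m) (y : Fin d → ℝ) :
    ((rectDiag m y)ᵀ * rectDiag m y).charpoly = ∏ i, (X - C (y i ^ 2)) := by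
  rw [rectDiag_transpose_mul_self hdm, charpoly_diagonal]

theorem exists_rectDiag_charpoly_of_posSemidef {m d : ℕ} (hdm : d ≤ m)
    {M : Matrix (Fin d) (Fin d) ℝ} (hM : M.PosSemidef) :
    ∃ y : Fin d → ℝ, ((rectDiag m y)ᵀ * rectDiag m y).charpoly = M.charpoly := by
  refine ⟨fun i => √(hM.1.eigenvalues i), ?_⟩
  rw [charpoly_rectDiag hdm, hM.1.charpoly_eq]
  simp [Real.sq_sqrt (hM.eigenvalues_nonneg _)]

theorem posSemidef_transpose_mul_self {m d : ℕ} (A : Matrix (Fin m) (Fin d) ℝ) :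
    (Aᵀ * A).PosSemidef := by
  simpa [conjTranspose_eq_transpose_of_trivial] using posSemidef_conjTranspose_mul_self A

/-! ### Laguerre polynomials are characteristic polynomials -/

theorem charpoly_diagonal_add_vecMulVec_const {n : Type*} [Fintype n] [DecidableEq n]
    (y : n → ℝ) (c : ℝ) :
    (diagonal y + vecMulVec (fun _ => c) (fun _ => c)).charpoly =
      (diagonal y).charpoly - c ^ 2 • derivative (diagonal y).charpoly := by
  have : (diagonal y).charmatrix = diagonal (fun i => X - C (y i)) := by
    ext i j : 2
    by_cases h : i = j
    · subst h; simp
    · simp [h]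
  rw [charpoly_add_vecMulVec, derivative_charpoly, trace, this, adjugate_diagonal,
    Finset.smul_sum]
  congr 1
  refine Finset.sum_congr rfl fun i _ => ?_
  rw [Finset.sum_eq_single i]
  · rw [diag_apply, smul_eq_C_mul, sq]
  · intro j _ hj
    simp [Ne.symm hj]
  · simp

/-- Each factor 1 - sD is realized by diagonalizing and adding a positive semidefinite rank one
matrix with all entries s: the adjugate is diagonal there, so only its trace, the derivative,
survives. -/
theorem exists_posSemidef_charpoly_eq_monicLaguerre (m d : ℕ) {s : ℝ} (hs : 0 ≤ s) :
    ∃ M : Matrix (Fin d) (Fin d) ℝ, M.PosSemidef ∧ M.charpoly = monicLaguerre m d s := by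
  induction m with
  | zero => exact ⟨0, PosSemidef.zero, by simp [monicLaguerre]⟩
  | succ m ih =>
    obtain ⟨M, hM, hMc⟩ := ih
    refine ⟨diagonal hM.1.eigenvalues + vecMulVec (fun _ => √s) (fun _ => √s), ?_, ?_⟩
    · refine (PosSemidef.diagonal fun i => hM.eigenvalues_nonneg i).add ?_
      simpa using posSemidef_vecMulVec_self_star (fun _ : Fin d => √s)
    · have : (diagonal hM.1.eigenvalues).charpoly = M.charpoly := by
        rw [charpoly_diagonal, hM.1.charpoly_eq]; simp
      rw [charpoly_diagonal_add_vecMulVec_const, this, hMc, Real.sq_sqrt hs, monicLaguerre,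
        monicLaguerre, pow_succ', Module.End.mul_apply]
      rfl

/-! ### Orthogonal equivalence -/

theorem exists_orthogonal_conj_of_charpoly_eq {n : Type*} [Fintype n] [DecidableEq n]
    {M M' : Matrix n n ℝ} (hM : M.IsHermitian) (hM' : M'.IsHermitian)
    (h : M.charpoly = M'.charpoly) :
    ∃ V : orthogonalGroup n ℝ, M' = V.val * M * V.valᵀ := by
  have he := (IsHermitian.eigenvalues_eq_eigenvalues_iff hM hM').mpr h
  have h1 := hM.conjStarAlgAut_star_eigenvectorUnitary
  have h2 := hM'.spectral_theorem
  rw [← he, ← h1, ← Unitary.conjStarAlgAut_mul_apply] at h2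
  exact ⟨hM'.eigenvectorUnitary * star hM.eigenvectorUnitary, h2⟩

/-- Equal Gram matrices make Ax ↦ Bx a well-defined isometry on the range of A, which extends to the
whole space. -/
theorem exists_orthogonal_mul_of_gram_eq {m d : ℕ} {A B : Matrix (Fin m) (Fin d) ℝ}
    (h : Aᵀ * A = Bᵀ * B) : ∃ U : orthogonalGroup (Fin m) ℝ, B = U.val * A := by
  let a := A.toEuclideanLin
  let b := B.toEuclideanLin
  have hnorm : ∀ x, ‖a x‖ = ‖b x‖ := by
    intro x
    have : ∀ M : Matrix (Fin m) (Fin d) ℝ, ‖M.toEuclideanLin x‖ ^ 2 =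
        x.ofLp ⬝ᵥ (Mᵀ * M) *ᵥ x.ofLp := by
      intro M
      rw [← real_inner_self_eq_norm_sq, EuclideanSpace.inner_eq_star_dotProduct,
        ← mulVec_mulVec, dotProduct_mulVec, vecMul_transpose]
      simp [toLpLin_apply]
    have h2 : ‖a x‖ ^ 2 = ‖b x‖ ^ 2 := by rw [this, this, h]
    exact (sq_eq_sq₀ (norm_nonneg _) (norm_nonneg _)).mp h2
  obtain ⟨r, hr⟩ := a.rangeRestrict.exists_rightInverse_of_surjective a.range_rangeRestrict
  have hr' : ∀ y, a (r y) = y := fun y => congrArg Subtype.val (LinearMap.congr_fun hr y)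
  let L : LinearMap.range a →ₗᵢ[ℝ] EuclideanSpace ℝ (Fin m) :=
    ⟨b ∘ₗ r, fun y => by rw [LinearMap.comp_apply, ← hnorm, hr', Submodule.coe_norm]⟩
  have hL : ∀ x, L.extend (a x) = b x := by
    intro x
    have h1 : L.extend (a x) = b (r (a.rangeRestrict x)) := L.extend_apply (a.rangeRestrict x)
    rw [h1, ← sub_eq_zero, ← map_sub, ← norm_eq_zero, ← hnorm, map_sub, hr']
    simp
  let F := L.extend
  let U : Matrix (Fin m) (Fin m) ℝ := of fun k l => F (EuclideanSpace.single l 1) k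
  have hU : star U * U = 1 := by
    ext k l
    have h1 : (star U * U) k l =
        inner ℝ (F (EuclideanSpace.single l 1)) (F (EuclideanSpace.single k 1)) := by
      rw [Matrix.mul_apply, PiLp.inner_apply]
      refine Finset.sum_congr rfl fun j _ => ?_
      simp [U]
    rw [h1, LinearIsometry.inner_map_map, EuclideanSpace.inner_single_left]
    simp [Matrix.one_apply, eq_comm]
  refine ⟨⟨U, (mem_orthogonalGroup_iff' _ _).mpr hU⟩, ?_⟩
  ext k j
  have h2 : a (EuclideanSpace.single j 1) = ∑ l, A l j • EuclideanSpace.single l (1 : ℝ) := by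
    ext l
    simp [a, toLpLin_apply, Pi.single_apply]
  have h3 := congrArg (fun v => v k) (hL (EuclideanSpace.single j 1))
  simp only [h2, map_sum, map_smul] at h3
  have h4 : b (EuclideanSpace.single j 1) k = B k j := by simp [b, toLpLin_apply]
  rw [← h4, ← h3, Matrix.mul_apply]
  simp [U, F, mul_comm]

/-! ### Dependence on a single entry -/

/-- By the Schur complement the determinant equals that of the block matrix with blocks xI, Kᵀ, K,
1. There t occurs linearly in just two rows. -/
theorem det_charpoly_add_single {m d : ℕ} (K : Matrix (Fin m) (Fin d) ℝ) (i : Fin m) (j : Fin d)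
    (x : ℝ) : ∃ a b c : ℝ, ∀ t : ℝ,
      (x • (1 : Matrix (Fin d) (Fin d) ℝ) -
        (K + Matrix.single i j t)ᵀ * (K + Matrix.single i j t)).det = a + b * t + c * t ^ 2 := by
  let N := fromBlocks (x • (1 : Matrix (Fin d) (Fin d) ℝ)) Kᵀ K 1
  let p : Fin d ⊕ Fin m := Sum.inl j
  let q : Fin d ⊕ Fin m := Sum.inr i
  have hpq : p ≠ q := Sum.inl_ne_inr
  have hN : ∀ t : ℝ, fromBlocks (x • (1 : Matrix (Fin d) (Fin d) ℝ))
      (K + Matrix.single i j t)ᵀ (K + Matrix.single i j t) 1 =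
      (N.updateRow p (N p + t • Pi.single q 1)).updateRow q (N q + t • Pi.single p 1) := by
    intro t
    ext u v
    rcases u with u | u <;> rcases v with v | v <;>
      simp only [N, p, q, updateRow_apply, Matrix.single_apply, Pi.single_apply, transpose_apply,
        fromBlocks_apply₁₁, fromBlocks_apply₁₂, fromBlocks_apply₂₁, fromBlocks_apply₂₂,
        Pi.add_apply, Pi.smul_apply, Matrix.add_apply, Sum.inl.injEq, Sum.inr.injEq,
        reduceCtorEq, if_false, smul_eq_mul, mul_zero, add_zero] <;>
      grind
  refine ⟨N.det, ((N.updateRow q (Pi.single p 1)).det + (N.updateRow p (Pi.single q 1)).det),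
    ((N.updateRow q (Pi.single p 1)).updateRow p (Pi.single q 1)).det, fun t => ?_⟩
  rw [← det_fromBlocks_one₂₂, hN, det_updateRow_add, det_updateRow_smul,
    updateRow_comm _ hpq, updateRow_comm _ hpq, det_updateRow_add, det_updateRow_add,
    det_updateRow_smul, det_updateRow_smul]
  have e : ∀ z, (N.updateRow q z).updateRow p (N p) = N.updateRow q z := by
    intro z
    rw [updateRow_comm _ hpq.symm, updateRow_eq_self]
  rw [e, e, updateRow_eq_self]
  ring

/-! ### Symmetric polynomials in squares -/

/-- The hypothesis says that f is affine in each y i ^ 2, so f is interpolated from the vertices of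
the cube, one coordinate at a time. -/
theorem eq_sum_vertices {ι : Type*} [Fintype ι] [DecidableEq ι] {f : (ι → ℝ) → ℝ}
    (hf : ∀ y i t, f (Function.update y i t) = (1 - t ^ 2) * f (Function.update y i 0) +
      t ^ 2 * f (Function.update y i 1)) (y : ι → ℝ) :
    f y = ∑ S : Finset ι, (∏ i ∈ S, y i ^ 2) * (∏ i ∈ Sᶜ, (1 - y i ^ 2)) *
      f (fun i => if i ∈ S then 1 else 0) := by
  have key : ∀ T : Finset ι, f y = ∑ S ∈ T.powerset,
      (∏ i ∈ S, y i ^ 2) * (∏ i ∈ T \ S, (1 - y i ^ 2)) *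
        f (fun i => if i ∈ T then (if i ∈ S then 1 else 0) else y i) := by
    intro T
    induction T using Finset.induction_on with
    | empty => simp
    | insert a T ha ih =>
      rw [Finset.sum_powerset_insert ha, ih, ← Finset.sum_add_distrib]
      refine Finset.sum_congr rfl fun S hS => ?_
      have haS : a ∉ S := fun h => ha (Finset.mem_powerset.mp hS h)
      have h := hf (fun i => if i ∈ T then (if i ∈ S then 1 else 0) else y i) a (y a)
      have e : Function.update (fun i => if i ∈ T then (if i ∈ S then (1 : ℝ) else 0) else y i)
          a (y a) = fun i => if i ∈ T then (if i ∈ S then 1 else 0) else y i := by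
        rw [Function.update_eq_self_iff]; simp [ha]
      have e0 : Function.update (fun i => if i ∈ T then (if i ∈ S then (1 : ℝ) else 0) else y i)
          a 0 = fun i => if i ∈ insert a T then (if i ∈ S then 1 else 0) else y i := by
        ext i
        by_cases hi : i = a
        · subst hi; simp [haS]
        · simp [hi]
      have e1 : Function.update (fun i => if i ∈ T then (if i ∈ S then (1 : ℝ) else 0) else y i)
          a 1 = fun i => if i ∈ insert a T then (if i ∈ insert a S then 1 else 0) else y i := by
        ext i
        by_cases hi : i = a
        · subst hi; simp
        · simp [hi]
      rw [e, e0, e1] at h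
      rw [h, Finset.prod_insert haS, Finset.insert_sdiff_of_notMem _ haS,
        Finset.prod_insert (by simp [ha]), Finset.insert_sdiff_insert, Finset.sdiff_insert_of_notMem ha]
      ring
  simpa [Finset.compl_eq_univ_sdiff] using key Finset.univ

/-- The linear map sending a polynomial `p` of degree at most `d` to
`∑ i, p.coeff i • (1 - X) ^ (d - i)`. -/
def reflectCompOneSub (d : ℕ) : ℝ[X] →ₗ[ℝ] ℝ[X] where
  toFun p := (reflect d p).comp (1 - X)
  map_add' p q := by rw [reflect_add, add_comp]
  map_smul' c p := by rw [smul_eq_C_mul, reflect_C_mul, mul_comp, C_comp, RingHom.id_apply,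
    smul_eq_C_mul]

/-- With z i = y i ^ 2, the coefficient of X^k on the right is the total interpolation weight of the
vertices with k ones. -/
theorem reflectCompOneSub_prod {d : ℕ} (z : Fin d → ℝ) :
    reflectCompOneSub d (∏ i, (X - C (z i))) = ∏ i, (C (z i) * X + C (1 - z i)) := by
  have h := (diagonal z).reverse_charpoly
  rw [reverse, charpoly_natDegree_eq_dim, Fintype.card_fin, charpoly_diagonal] at h
  change (reflect d _).comp (1 - X) = _
  have e : (1 - (X : ℝ[X]) • (diagonal z).map C) = diagonal fun i => 1 - X * C (z i) := by
    ext i j : 2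
    by_cases hij : i = j
    · subst hij; simp
    · simp [hij]
  rw [h, charpolyRev, e, det_diagonal, prod_comp]
  refine Finset.prod_congr rfl fun i _ => ?_
  simp
  ring

/-- By symmetry the value of f at a vertex depends only on its number of ones, so the interpolation
formula is a linear functional of the coefficients of the product after `reflectCompOneSub`. -/
theorem exists_linear_of_symmetric {d : ℕ} {f : (Fin d → ℝ) → ℝ}
    (hf : ∀ y i t, f (Function.update y i t) = (1 - t ^ 2) * f (Function.update y i 0) +
      t ^ 2 * f (Function.update y i 1))
    (hsymm : ∀ y z : Fin d → ℝ,
      ∏ i, (X - C (y i ^ 2)) = ∏ i, (X - C (z i ^ 2)) → f y = f z) :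
    ∃ L : ℝ[X] →ₗ[ℝ] ℝ, ∀ y, f y = L (∏ i, (X - C (y i ^ 2))) := by
  obtain ⟨φ, hφ⟩ : ∃ φ : ℕ → ℝ,
      (fun S : Finset (Fin d) => f (fun i => if i ∈ S then 1 else 0)) = φ ∘ Finset.card := by
    rw [← Function.factorsThrough_iff]
    intro S T hST
    apply hsymm
    have : ∀ S : Finset (Fin d), ∏ i, (X - C ((if i ∈ S then (1 : ℝ) else 0) ^ 2)) =
        (X - 1) ^ S.card * X ^ (d - S.card) := by
      intro S
      have : ∀ i, (X - C ((if i ∈ S then (1 : ℝ) else 0) ^ 2)) = if i ∈ S then X - 1 else X := by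
        intro i; split_ifs <;> simp
      simp only [this, Finset.prod_ite, Finset.prod_const, Finset.filter_univ_mem]
      congr 2
      rw [← Finset.compl_filter, Finset.filter_univ_mem, Finset.card_compl, Fintype.card_fin]
    rw [this, this, hST]
  let Φ : ℝ[X] →ₗ[ℝ] ℝ := ∑ k ∈ Finset.range (d + 1), φ k • lcoeff ℝ k
  have hΦ : ∀ k ≤ d, Φ (X ^ k) = φ k := by
    intro k hk
    simp only [Φ, LinearMap.sum_apply, LinearMap.smul_apply, lcoeff_apply, coeff_X_pow,
      smul_eq_mul, mul_ite, mul_one, mul_zero, Finset.sum_ite_eq', Finset.mem_range]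
    rw [if_pos (by omega)]
  refine ⟨Φ ∘ₗ reflectCompOneSub d, fun y => ?_⟩
  rw [LinearMap.comp_apply, reflectCompOneSub_prod, Fintype.prod_add, map_sum, eq_sum_vertices hf]
  refine Finset.sum_congr rfl fun S _ => ?_
  have hS : S.card ≤ d := by simpa using S.card_le_univ
  rw [Finset.prod_mul_distrib, Finset.prod_const, ← map_prod, ← map_prod, mul_right_comm (C _), ← C_mul,
    ← smul_eq_C_mul, map_smul, hΦ _ hS, smul_eq_mul]
  exact congrArg _ (congrFun hφ S)

/-! ### Averages over the orthogonal groups -/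

instance orthogonalHaar_isHaarMeasure (n : ℕ) : (orthogonalHaar n).IsHaarMeasure := by
  unfold orthogonalHaar; infer_instance

instance orthogonalHaar_isMulRightInvariant (n : ℕ) :
    (orthogonalHaar n).IsMulRightInvariant where
  map_mul_right_eq_self g := by
    have : IsProbabilityMeasure ((orthogonalHaar n).map (· * g)) :=
      Measure.isProbabilityMeasure_map (measurable_mul_const g).aemeasurable
    exact Measure.isHaarMeasure_eq_of_isProbabilityMeasure _ _

theorem continuous_charpoly_rotation {m d : ℕ} (A B : Matrix (Fin m) (Fin d) ℝ) (x : ℝ) :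
    Continuous fun z : orthogonalGroup (Fin m) ℝ × orthogonalGroup (Fin d) ℝ =>
      (x • (1 : Matrix (Fin d) (Fin d) ℝ) -
        (A + z.1.val * B * z.2.valᵀ)ᵀ * (A + z.1.val * B * z.2.valᵀ)).det := by
  have h1 : Continuous fun z : orthogonalGroup (Fin m) ℝ × orthogonalGroup (Fin d) ℝ =>
      A + z.1.val * B * z.2.valᵀ :=
    continuous_const.add (((continuous_subtype_val.comp continuous_fst).matrix_mul
      continuous_const).matrix_mul
        (continuous_subtype_val.comp continuous_snd).matrix_transpose)
  exact (continuous_const.sub (h1.matrix_transpose.matrix_mul h1)).matrix_det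

theorem integral_orthogonal_sum {m d : ℕ} {ι : Type*} [Fintype ι] (c : ι → ℝ)
    {h : ι → orthogonalGroup (Fin m) ℝ → orthogonalGroup (Fin d) ℝ → ℝ}
    (hh : ∀ l, Continuous (Function.uncurry (h l))) :
    ∫ Q, ∫ R, ∑ l, c l * h l Q R ∂(orthogonalHaar d) ∂(orthogonalHaar m) =
      ∑ l, c l * ∫ Q, ∫ R, h l Q R ∂(orthogonalHaar d) ∂(orthogonalHaar m) := by
  have : FirstCountableTopology (Matrix (Fin m) (Fin m) ℝ) :=
    inferInstanceAs (FirstCountableTopology (Fin m → Fin m → ℝ))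
  have : FirstCountableTopology (orthogonalGroup (Fin m) ℝ) :=
    Topology.IsInducing.subtypeVal.firstCountableTopology
  have hcont : ∀ l, Continuous fun Q => ∫ R, h l Q R ∂(orthogonalHaar d) := by
    intro l
    simpa using continuous_parametric_integral_of_continuous (μ := orthogonalHaar d) (hh l)
      isCompact_univ
  have hint : ∀ {n : ℕ} {g : orthogonalGroup (Fin n) ℝ → ℝ}, Continuous g →
      Integrable g (orthogonalHaar n) := fun hg =>
    hg.integrable_of_hasCompactSupport (HasCompactSupport.of_compactSpace _)
  have hinner : ∀ Q, ∫ R, ∑ l, c l * h l Q R ∂(orthogonalHaar d) =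
      ∑ l, c l * ∫ R, h l Q R ∂(orthogonalHaar d) := by
    intro Q
    rw [integral_finsetSum _ fun l _ => (hint (g := h l Q)
      ((hh l).comp (Continuous.prodMk_right Q))).const_mul _]
    simp only [integral_const_mul]
  simp only [hinner]
  rw [integral_finsetSum _ fun l _ => (hint (hcont l)).const_mul _]
  simp only [integral_const_mul]

theorem sum_mul_avgCharpoly {m d : ℕ} {ι : Type*} [Fintype ι] (c : ι → ℝ)
    (A : Matrix (Fin m) (Fin d) ℝ) (B : ι → Matrix (Fin m) (Fin d) ℝ) (x : ℝ) :
    ∑ l, c l * avgCharpoly A (B l) x =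
      ∫ Q : orthogonalGroup (Fin m) ℝ, ∫ R : orthogonalGroup (Fin d) ℝ,
        ∑ l, c l * (x • (1 : Matrix (Fin d) (Fin d) ℝ) -
          (A + Q.val * B l * R.valᵀ)ᵀ * (A + Q.val * B l * R.valᵀ)).det
        ∂(orthogonalHaar d) ∂(orthogonalHaar m) :=
  (integral_orthogonal_sum c fun l => continuous_charpoly_rotation A (B l) x).symm

/-- Equal characteristic polynomials give B' = UBVᵀ with U and V orthogonal, and right invariance of
the Haar measures absorbs both. -/
theorem avgCharpoly_congr {m d : ℕ} (A : Matrix (Fin m) (Fin d) ℝ)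
    {B B' : Matrix (Fin m) (Fin d) ℝ} (h : (Bᵀ * B).charpoly = (B'ᵀ * B').charpoly) (x : ℝ) :
    avgCharpoly A B x = avgCharpoly A B' x := by
  obtain ⟨V, hV⟩ := exists_orthogonal_conj_of_charpoly_eq
    (posSemidef_transpose_mul_self B).1 (posSemidef_transpose_mul_self B').1 h
  obtain ⟨U, hU⟩ := exists_orthogonal_mul_of_gram_eq (A := B * V.valᵀ) (B := B') (by
    rw [hV, transpose_mul, transpose_transpose]; simp only [Matrix.mul_assoc])
  let g : orthogonalGroup (Fin m) ℝ → orthogonalGroup (Fin d) ℝ → ℝ := fun Q R =>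
    (x • (1 : Matrix (Fin d) (Fin d) ℝ) -
      (A + Q.val * B * R.valᵀ)ᵀ * (A + Q.val * B * R.valᵀ)).det
  have hg : avgCharpoly A B' x =
      ∫ Q, ∫ R, g (Q * U) (R * V) ∂(orthogonalHaar d) ∂(orthogonalHaar m) := by
    unfold avgCharpoly
    refine integral_congr_ae (.of_forall fun Q => integral_congr_ae (.of_forall fun R => ?_))
    have : Q.val * B' * R.valᵀ = (Q * U).val * B * (R * V).valᵀ := by
      rw [hU, Submonoid.coe_mul, Submonoid.coe_mul, transpose_mul]
      simp only [Matrix.mul_assoc]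
    simp only [g, this]
  rw [hg]
  have hR : ∀ Q, ∫ R, g Q (R * V) ∂(orthogonalHaar d) = ∫ R, g Q R ∂(orthogonalHaar d) :=
    fun Q => integral_mul_right_eq_self (g Q) V
  simp only [hR]
  rw [integral_mul_right_eq_self fun Q => ∫ R, g Q R ∂(orthogonalHaar d)]
  rfl

/-- Moves the rotations from B to A, so that an entry of B enters the determinant unrotated. -/
theorem det_charpoly_conj {m d : ℕ} (A B : Matrix (Fin m) (Fin d) ℝ)
    (Q : orthogonalGroup (Fin m) ℝ) (R : orthogonalGroup (Fin d) ℝ) (x : ℝ) :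
    (x • (1 : Matrix (Fin d) (Fin d) ℝ) -
      (A + Q.val * B * R.valᵀ)ᵀ * (A + Q.val * B * R.valᵀ)).det =
    (x • (1 : Matrix (Fin d) (Fin d) ℝ) -
      (Q.valᵀ * A * R.val + B)ᵀ * (Q.valᵀ * A * R.val + B)).det := by
  have hQ : Q.valᵀ * Q.val = 1 := (mem_orthogonalGroup_iff' _ _).mp Q.2
  have hQ' : Q.val * Q.valᵀ = 1 := (mem_orthogonalGroup_iff _ _).mp Q.2
  have hR : R.valᵀ * R.val = 1 := (mem_orthogonalGroup_iff' _ _).mp R.2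
  have hR' : R.val * R.valᵀ = 1 := (mem_orthogonalGroup_iff _ _).mp R.2
  set K := Q.valᵀ * A * R.val + B with hK
  have e : A + Q.val * B * R.valᵀ = Q.val * K * R.valᵀ := by
    have : Q.val * (Q.valᵀ * A * R.val) * R.valᵀ = (Q.val * Q.valᵀ) * A * (R.val * R.valᵀ) := by
      simp only [Matrix.mul_assoc]
    rw [hK, Matrix.mul_add, Matrix.add_mul, this, hQ', hR', Matrix.one_mul, Matrix.mul_one]
  have e2 : x • (1 : Matrix (Fin d) (Fin d) ℝ) - (Q.val * K * R.valᵀ)ᵀ * (Q.val * K * R.valᵀ) =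
      R.val * (x • 1 - Kᵀ * K) * R.valᵀ := by
    have : (Q.val * K * R.valᵀ)ᵀ * (Q.val * K * R.valᵀ) =
        R.val * (Kᵀ * (Q.valᵀ * Q.val) * K) * R.valᵀ := by
      simp only [transpose_mul, transpose_transpose, Matrix.mul_assoc]
    rw [this, hQ, Matrix.mul_sub, Matrix.sub_mul, Matrix.mul_one, Matrix.mul_smul,
      Matrix.mul_one, Matrix.smul_mul, hR']
  rw [e, e2, det_mul, det_mul, mul_right_comm, ← det_mul, hR', det_one, one_mul]

theorem avgCharpoly_rectDiag_update {m d : ℕ} (hdm : d ≤ m) (A : Matrix (Fin m) (Fin d) ℝ)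
    (x : ℝ) (y : Fin d → ℝ) (i : Fin d) (t : ℝ) :
    avgCharpoly A (rectDiag m (Function.update y i t)) x =
      (1 - t ^ 2) * avgCharpoly A (rectDiag m (Function.update y i 0)) x +
        t ^ 2 * avgCharpoly A (rectDiag m (Function.update y i 1)) x := by
  have hneg : avgCharpoly A (rectDiag m (Function.update y i (-1))) x =
      avgCharpoly A (rectDiag m (Function.update y i 1)) x := by
    apply avgCharpoly_congr
    rw [charpoly_rectDiag hdm, charpoly_rectDiag hdm]
    refine Finset.prod_congr rfl fun j _ => ?_
    by_cases hj : j = i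
    · subst hj; simp
    · simp [hj]
  -- Lagrange weights at the nodes 0, 1, -1, exact for quadratics in t. The nodes 1 and -1 give
  -- equal averages, and their weights add up to t ^ 2.
  have h3 := sum_mul_avgCharpoly ![1 - t ^ 2, (t + t ^ 2) / 2, (t ^ 2 - t) / 2] A
    (fun l => rectDiag m (Function.update y i (![(0 : ℝ), 1, -1] l))) x
  have hI : avgCharpoly A (rectDiag m (Function.update y i t)) x =
      ∑ l, ![1 - t ^ 2, (t + t ^ 2) / 2, (t ^ 2 - t) / 2] l *
        avgCharpoly A (rectDiag m (Function.update y i (![(0 : ℝ), 1, -1] l))) x := by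
    rw [h3, avgCharpoly]
    congr! with Q R
    simp only [det_charpoly_conj, rectDiag_update hdm y i t, rectDiag_update hdm y i (![_, _, _] _),
      ← add_assoc]
    obtain ⟨a, b, c, habc⟩ := det_charpoly_add_single
      (Q.valᵀ * A * R.val + rectDiag m (Function.update y i 0)) (Fin.castLE hdm i) i x
    simp only [habc]
    simp [Fin.sum_univ_three]
    ring
  rw [hI]
  simp [Fin.sum_univ_three, hneg]
  ring

theorem exists_linear_avgCharpoly {m d : ℕ} (hdm : d ≤ m) (A : Matrix (Fin m) (Fin d) ℝ)
    (x : ℝ) : ∃ L : ℝ[X] →ₗ[ℝ] ℝ, ∀ B : Matrix (Fin m) (Fin d) ℝ,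
      avgCharpoly A B x = L (Bᵀ * B).charpoly := by
  obtain ⟨L, hL⟩ := exists_linear_of_symmetric
    (f := fun y => avgCharpoly A (rectDiag m y) x) (avgCharpoly_rectDiag_update hdm A x)
    (fun y z h => avgCharpoly_congr A (by rwa [charpoly_rectDiag hdm, charpoly_rectDiag hdm]) x)
  refine ⟨L, fun B => ?_⟩
  obtain ⟨y, hy⟩ := exists_rectDiag_charpoly_of_posSemidef (m := m) hdm
    (posSemidef_transpose_mul_self B)
  rw [← avgCharpoly_congr A hy, ← hy, charpoly_rectDiag hdm]
  exact hL y

/-! ### Convolution with a Laguerre polynomial -/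

/-- The signed and scaled standard basis vectors, whose uniform law has covariance `s • 1`. -/
def signedBasis (d : ℕ) (s : ℝ) (ω : Fin d × Bool) : Fin d → ℝ :=
  Pi.single ω.1 ((if ω.2 then 1 else -1) * √(s * d))

/-- Each axis is hit with probability 1/d, which the squared length s * d compensates; the two signs
cancel the mean. -/
theorem isIsotropic_signedBasis {d : ℕ} (hd : 1 ≤ d) {s : ℝ} (hs : 0 ≤ s) :
    IsIsotropic (fun _ => (2 * d : ℝ)⁻¹) (signedBasis d s) s where
  mass := by
    have : (d : ℝ) ≠ 0 := by positivity
    simp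
    field_simp
  mean i := by
    simp [Fintype.sum_prod_type, signedBasis, Pi.single_apply]
  cov i j := by
    have hd0 : (d : ℝ) ≠ 0 := by positivity
    have hsq : √(s * d) * √(s * d) = s * d := Real.mul_self_sqrt (by positivity)
    by_cases hij : i = j
    · subst hij
      simp only [signedBasis]
      generalize √(s * d) = c at hsq
      simp [Fintype.sum_prod_type, Pi.single_apply]
      field_simp
      linear_combination 2 * hsq
    · simp [Fintype.sum_prod_type, signedBasis, Pi.single_apply, hij]

theorem IsIsotropic.rotate {Ω : Type*} [Fintype Ω] {d : ℕ} {w : Ω → ℝ} {v : Ω → Fin d → ℝ}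
    {s : ℝ} (h : IsIsotropic w v s) (R : orthogonalGroup (Fin d) ℝ) :
    IsIsotropic w (fun ω => R.val *ᵥ v ω) s where
  mass := h.mass
  mean i := by
    simp only [mulVec, dotProduct, Finset.mul_sum]
    rw [Finset.sum_comm]
    refine Finset.sum_eq_zero fun j _ => ?_
    simp only [mul_left_comm (w _), ← Finset.mul_sum, h.mean, mul_zero]
  cov i j := by
    have hR : R.val * R.valᵀ = 1 := (mem_orthogonalGroup_iff _ _).mp R.2
    have hij := congrFun (congrFun hR i) j
    rw [Matrix.mul_apply, Matrix.one_apply] at hij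
    have e : ∀ ω, w ω * ((R.val *ᵥ v ω) i * (R.val *ᵥ v ω) j) =
        ∑ k, ∑ l, (R.val i k * R.val j l) * (w ω * (v ω k * v ω l)) := by
      intro ω
      rw [mulVec, mulVec, dotProduct, dotProduct, Finset.sum_mul_sum, Finset.mul_sum]
      refine Finset.sum_congr rfl fun k _ => ?_
      rw [Finset.mul_sum]
      exact Finset.sum_congr rfl fun l _ => by ring
    simp only [e]
    rw [Finset.sum_comm]
    simp only [Finset.sum_comm (s := (Finset.univ : Finset Ω)), ← Finset.mul_sum, h.cov]
    simp only [mul_ite, mul_zero, Finset.sum_ite_eq, Finset.mem_univ, if_true, ← Finset.sum_mul]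
    simp only [transpose_apply] at hij
    rw [hij]
    split_ifs <;> simp

theorem IsIsotropic.sum_charpoly_gram {Ω : Type*} [Fintype Ω] {m d : ℕ} (hdm : d ≤ m) {w : Ω → ℝ}
    {v : Ω → Fin d → ℝ} {s : ℝ} (h : IsIsotropic w v s) (A : Matrix (Fin m) (Fin d) ℝ) :
    ∑ ω : Fin m → Ω, (∏ k, w (ω k)) •
        ((A + of fun k => v (ω k))ᵀ * (A + of fun k => v (ω k))).charpoly =
      rectOp m d s (Aᵀ * A).charpoly := by
  rw [← sum_derivative_charpoly_remove_rows hdm]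
  have := h.sum_charpoly_rows 0 A
  simp only [zero_add] at this
  rw [← this]
  refine Finset.sum_congr rfl fun ω _ => ?_
  rw [transpose_mul_self_eq_sum]
  rfl

theorem avgCharpoly_eq_rectOp {m d : ℕ} (hd : 1 ≤ d) (hdm : d ≤ m)
    (A B : Matrix (Fin m) (Fin d) ℝ) {s : ℝ} (hs : 0 ≤ s)
    (hB : (Bᵀ * B).charpoly = monicLaguerre m d s) (x : ℝ) :
    avgCharpoly A B x = (rectOp m d s (Aᵀ * A).charpoly).eval x := by
  have hiso := isIsotropic_signedBasis hd hs
  set v := signedBasis d s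
  set w : Fin d × Bool → ℝ := fun _ => (2 * d : ℝ)⁻¹
  obtain ⟨L, hL⟩ := exists_linear_avgCharpoly hdm A x
  -- With A = 0 the starting polynomial is X^d, the Laguerre polynomial at scale 0. Hence the mean
  -- over V of the characteristic polynomial of VᵀV is that of BᵀB, and the linear functional L
  -- carries this over to `avgCharpoly`.
  have h0 := hiso.sum_charpoly_gram hdm (0 : Matrix (Fin m) (Fin d) ℝ)
  have hX : ((0 : Matrix (Fin m) (Fin d) ℝ)ᵀ *
      (0 : Matrix (Fin m) (Fin d) ℝ)).charpoly = monicLaguerre m d 0 := by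
    simp [monicLaguerre]
  rw [hX, rectOp_monicLaguerre hdm, add_zero, ← hB] at h0
  simp only [zero_add] at h0
  have h1 := congrArg L h0
  simp only [map_sum, map_smul, ← hL, smul_eq_mul] at h1
  rw [← h1, sum_mul_avgCharpoly (fun ω : Fin m → Fin d × Bool => ∏ k, w (ω k))]
  have hconst : ∀ (Q : orthogonalGroup (Fin m) ℝ) (R : orthogonalGroup (Fin d) ℝ),
      ∑ ω : Fin m → Fin d × Bool, (∏ k, w (ω k)) *
        (x • (1 : Matrix (Fin d) (Fin d) ℝ) -
          (A + Q.val * (of fun k => v (ω k)) * R.valᵀ)ᵀ *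
            (A + Q.val * (of fun k => v (ω k)) * R.valᵀ)).det =
      (rectOp m d s (Aᵀ * A).charpoly).eval x := by
    intro Q R
    have hQ' : Q.val * Q.valᵀ = 1 := (mem_orthogonalGroup_iff _ _).mp Q.2
    -- Q is absorbed into A without changing its Gram matrix, while R rotates the law of each row.
    have h2 := (hiso.rotate R).sum_charpoly_gram hdm (Q.valᵀ * A)
    have hg : (Q.valᵀ * A)ᵀ * (Q.valᵀ * A) = Aᵀ * A := by
      rw [transpose_mul, transpose_transpose, Matrix.mul_assoc, ← Matrix.mul_assoc Q.val, hQ',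
        Matrix.one_mul]
    rw [hg] at h2
    rw [← h2, eval_finsetSum]
    refine Finset.sum_congr rfl fun ω _ => ?_
    have hrow : (of fun k => R.val *ᵥ v (ω k) : Matrix (Fin m) (Fin d) ℝ) =
        (of fun k => v (ω k)) * R.valᵀ := by
      ext k j
      simp [Matrix.mul_apply, mulVec, dotProduct, mul_comm]
    have h3 := det_charpoly_conj A ((of fun k => v (ω k)) * R.valᵀ) Q 1 x
    rw [Submonoid.coe_one, transpose_one, Matrix.mul_one, Matrix.mul_one, ← Matrix.mul_assoc] at h3
    rw [h3, eval_smul, smul_eq_mul, eval_charpoly, hrow, smul_one_eq_diagonal]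
    rfl
  simp only [hconst]
  simp

/-! ### Normalization of the Laguerre polynomials -/

theorem laguerrePoly_comp_eq {m d : ℕ} (hdm : d ≤ m) {s : ℝ} (hs : 0 < s) :
    (laguerrePoly d (m - d)).comp (C (1 / s) * X) =
      C ((-1) ^ d / (d.factorial * s ^ d)) * monicLaguerre m d s := by
  rw [monicLaguerre_eq_sum, laguerrePoly, Nat.add_sub_cancel' hdm,
    ← Finset.sum_subset (Finset.range_mono (Nat.succ_le_succ hdm)),
    -- The index is reversed because D^i X^d has degree d - i; the terms with i > d vanish.
    ← Finset.sum_range_reflect _ (d + 1), Finset.mul_sum, Polynomial.sum_comp]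
  · refine Finset.sum_congr rfl fun i hi => ?_
    have hid : i ≤ d := Nat.lt_succ_iff.mp (Finset.mem_range.mp hi)
    have h1 : d + 1 - 1 - i = d - i := rfl
    have h2 : d - (d - i) = i := Nat.sub_sub_self hid
    rw [h1, iterate_derivative_X_pow_eq_smul, h2, mul_comp, C_comp, pow_comp, X_comp, mul_pow,
      ← C_pow, smul_smul, smul_eq_C_mul, ← mul_assoc, ← mul_assoc, ← C_mul, ← C_mul]
    congr 2
    rw [← Nat.factorial_mul_descFactorial hid]
    obtain ⟨k, rfl⟩ := Nat.exists_eq_add_of_le hid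
    have h3 : ((i + k).descFactorial i : ℝ) ≠ 0 :=
      Nat.cast_ne_zero.mpr (Nat.descFactorial_pos.mpr hid).ne'
    have h4 : (-1 : ℝ) ^ i * (-1) ^ i = 1 := by rw [← mul_pow]; simp
    rw [Nat.add_sub_cancel_left, neg_pow s i, div_pow, one_pow]
    push_cast
    field_simp
    linear_combination (-(m.choose i : ℝ) * s ^ (i + k) * (-1 : ℝ) ^ k) * h4
  · intro k _ hk
    have : d < k := by simpa using hk
    rw [iterate_derivative_X_pow_eq_smul, Nat.descFactorial_of_lt this]
    simp

theorem isSingularCharpoly_C_mul_iff {m d : ℕ} {c : ℝ} (hc : c ≠ 0) {p : ℝ[X]} (hp : p.Monic)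
    (A : Matrix (Fin m) (Fin d) ℝ) :
    IsSingularCharpoly A (C c * p) ↔ (Aᵀ * A).charpoly = p := by
  rw [IsSingularCharpoly, leadingCoeff_mul, leadingCoeff_C, hp.leadingCoeff, mul_one,
    mul_right_inj' (C_ne_zero.mpr hc), eq_comm]

theorem exists_charpoly_eq_monicLaguerre {m d : ℕ} (hdm : d ≤ m) {s : ℝ} (hs : 0 ≤ s) :
    ∃ A : Matrix (Fin m) (Fin d) ℝ, (Aᵀ * A).charpoly = monicLaguerre m d s := by
  obtain ⟨M, hM, hMc⟩ := exists_posSemidef_charpoly_eq_monicLaguerre m d hs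
  obtain ⟨y, hy⟩ := exists_rectDiag_charpoly_of_posSemidef (m := m) hdm hM
  exact ⟨rectDiag m y, hy.trans hMc⟩

theorem monicLaguerre_monic {m d : ℕ} {s : ℝ} (hs : 0 ≤ s) : (monicLaguerre m d s).Monic := by
  obtain ⟨M, _, hMc⟩ := exists_posSemidef_charpoly_eq_monicLaguerre m d hs
  exact hMc ▸ M.charpoly_monic

end

/-- Divisibility of the Laguerre polynomials. -/
theorem mainTheorem12 (m d : ℕ) (hd : 1 ≤ d) (hdm : d ≤ m) (σ τ : ℝ)
    (hσ : 0 < σ ^ 2) (hτ : 0 < τ ^ 2) :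
    ∃ r : ℝ[X],
      IsRectConv m d
        ((laguerrePoly d (m - d)).comp (C (1 / σ ^ 2) * X))
        ((laguerrePoly d (m - d)).comp (C (1 / τ ^ 2) * X)) r ∧
      EqUpToScaling
        ((laguerrePoly d (m - d)).comp (C (1 / (σ ^ 2 + τ ^ 2)) * X)) r := by
  have hc : ∀ s : ℝ, 0 < s → (-1 : ℝ) ^ d / (d.factorial * s ^ d) ≠ 0 := fun s hs =>
    div_ne_zero (pow_ne_zero _ (by norm_num)) (by positivity)
  have hlead : ∀ s : ℝ, 0 < s →
      (C ((-1 : ℝ) ^ d / (d.factorial * s ^ d)) * monicLaguerre m d s).leadingCoeff =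
        (-1 : ℝ) ^ d / (d.factorial * s ^ d) := fun s hs => by
    rw [leadingCoeff_mul, leadingCoeff_C, (monicLaguerre_monic hs.le).leadingCoeff, mul_one]
  have hsum := add_pos hσ hτ
  rw [laguerrePoly_comp_eq hdm hσ, laguerrePoly_comp_eq hdm hτ, laguerrePoly_comp_eq hdm hsum]
  have hcσ := hc _ hσ
  have hcτ := hc _ hτ
  have hcs := hc _ hsum
  have hlσ := hlead _ hσ
  have hlτ := hlead _ hτ
  generalize (-1 : ℝ) ^ d / (d.factorial * (σ ^ 2) ^ d) = a at *
  generalize (-1 : ℝ) ^ d / (d.factorial * (τ ^ 2) ^ d) = b at *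
  generalize (-1 : ℝ) ^ d / (d.factorial * (σ ^ 2 + τ ^ 2) ^ d) = c at *
  -- Here a, b, c are the leading coefficients of the three rescaled Laguerre polynomials.
  refine ⟨C (a * b) * monicLaguerre m d (σ ^ 2 + τ ^ 2), ⟨?_, ?_, ?_⟩, c / (a * b), ?_, ?_⟩
  · simp only [isSingularCharpoly_C_mul_iff hcσ (monicLaguerre_monic hσ.le)]
    exact exists_charpoly_eq_monicLaguerre hdm hσ.le
  · simp only [isSingularCharpoly_C_mul_iff hcτ (monicLaguerre_monic hτ.le)]
    exact exists_charpoly_eq_monicLaguerre hdm hτ.le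
  · intro A B hA hB x
    rw [isSingularCharpoly_C_mul_iff hcσ (monicLaguerre_monic hσ.le)] at hA
    rw [isSingularCharpoly_C_mul_iff hcτ (monicLaguerre_monic hτ.le)] at hB
    rw [hlσ, hlτ, avgCharpoly_eq_rectOp hd hdm A B hτ.le hB, hA, rectOp_monicLaguerre hdm,
      eval_mul, eval_C, add_comm (τ ^ 2)]
  · exact div_ne_zero hcs (mul_ne_zero hcσ hcτ)
  · rw [← mul_assoc, ← C_mul, div_mul_cancel₀ _ (mul_ne_zero hcσ hcτ)]
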